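/- For a finite graph $H$, let the size Ramsey number $\hat r(H)$ be the minimum number of edges in a finite graph $G$ such that every two-coloring of the edges of $G$ contains a monochromatic (not necessarily induced) copy of $H$. Let $K_{s,t}$ be the complete bipartite graph with parts of sizes $s$ and $t$, and let $\log$ be the base-$2$ logarithm. For every real $c>0$ there are real constants $a,b>0$, depending only on $c$, such that for all positive integers $s,t$ with $t\ge c\,s\log s$, $$a\,s^2t\,2^s\;\le\;\hat r(K_{s,t})\;\le\; b\,s^2t\,2^s .$$ In other words, if $t=\Omega(s\log s)$, then $\hat r(K_{s,t})=\Theta(s^2t2^s)$. -/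

import Mathlib

/-- `G` is Ramsey for `H`: every two-coloring of the edges of `G` contains a monochromatic
copy of `H` (`χ.labelGraph i` is the graph on the vertices of `G` formed by the edges of
color `i`, and `A.IsContained B` means that `B` has a not necessarily induced copy of `A`). -/
def IsRamseyFor {V W : Type*} (G : SimpleGraph V) (H : SimpleGraph W) : Prop :=
  ∀ χ : G.EdgeLabeling (Fin 2), ∃ i : Fin 2, H.IsContained (χ.labelGraph i)

/-- The size Ramsey number of `H`: the minimum number of edges in a finite graph that is
Ramsey for `H`. -/
noncomputable def sizeRamsey {W : Type*} (H : SimpleGraph W) : ℕ :=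
  sInf {m : ℕ | ∃ (n : ℕ) (G : SimpleGraph (Fin n)), IsRamseyFor G H ∧ G.edgeSet.ncard = m}

open Finset SimpleGraph

/-! Upper bound: two-color the complete bipartite graph with sides `4 s ^ 2` and `4 t 2 ^ s`. Every
vertex of the second side sends at least half of its edges in one color, and half of these vertices
agree on the color. Passing from a `4 s ^ 2`-set to half of it divides the number of `s`-subsets by
at most `2 * 2 ^ s`, so by double counting some `s`-set lies in `t` of the neighborhoods
(`isRamseyFor_completeBipartiteGraph`).

Lower bound: a random coloring and a union bound. A vertex of degree below `s ^ 2` splits its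
neighbors of high degree exactly in half; all other edges are colored independently. Sampling
without replacement makes it less likely that `s` given neighbors of a vertex of small degree `d`
get one color: the probability is `O(2 ^ (-s) * d / s ^ 2)` (`halfRatio_le_mul_div`). Since the
degrees sum to `2m`, where `m` is the number of edges, the expected number of vertices joined to a
fixed `S` of high-degree vertices in one color is `O(2 ^ (-s) * m / s ^ 2)`, a small multiple of `t`
when `m` is below the bound.

Two kinds of copies `S × T` are counted. If `S` has a low vertex, then `T` lies in its small
neighborhood and the crude probability `2 ^ (s + t - s * t)` suffices (`sum_monoEvent_low_le`).
Otherwise `S` lies in the neighborhood of a vertex of minimum degree in `T`; the total is about `m *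
(s ^ 2) ^ s` times a small constant to the power `t` (`sum_monoEvent_high_le`), and `t ≥ c s log s`
absorbs `(s ^ 2) ^ s`. -/

/-! ### Basic facts on size Ramsey numbers -/

theorem IsRamseyFor.overFin {V W : Type*} [Fintype V] {G : SimpleGraph V} {H : SimpleGraph W}
    (h : IsRamseyFor G H) : IsRamseyFor (G.overFin (n := Fintype.card V) rfl) H := by
  let φ := G.overFinIso (n := Fintype.card V) rfl
  intro χ
  obtain ⟨i, hi⟩ := h (χ.pullback φ.toHom)
  refine ⟨i, hi.trans ⟨⟨⟨φ, fun {x y} hxy => ?_⟩, φ.injective⟩⟩⟩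
  rw [EdgeLabeling.labelGraph_adj] at hxy ⊢
  obtain ⟨h₁, h₂⟩ := hxy
  exact ⟨φ.map_rel_iff.2 h₁, h₂⟩

/-- A Ramsey graph on an arbitrary finite vertex type bounds the size Ramsey number. -/
theorem sizeRamsey_le_ncard {V W : Type*} [Fintype V] {G : SimpleGraph V} {H : SimpleGraph W}
    (h : IsRamseyFor G H) : sizeRamsey H ≤ G.edgeSet.ncard :=
  Nat.sInf_le ⟨_, _, h.overFin, (Nat.card_congr (G.overFinIso rfl).mapEdgeSet).symm⟩

/-- If `H` has a finite Ramsey graph, then the size Ramsey number of `H` is attained. -/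
theorem exists_isRamseyFor_ncard_eq_sizeRamsey {V W : Type*} [Fintype V] {G : SimpleGraph V}
    {H : SimpleGraph W} (h : IsRamseyFor G H) :
    ∃ (n : ℕ) (G' : SimpleGraph (Fin n)), IsRamseyFor G' H ∧ G'.edgeSet.ncard = sizeRamsey H :=
  Nat.sInf_mem (s := {m : ℕ | ∃ (n : ℕ) (G : SimpleGraph (Fin n)),
    IsRamseyFor G H ∧ G.edgeSet.ncard = m}) ⟨_, _, _, h.overFin, rfl⟩

theorem ncard_edgeSet_completeBipartiteGraph (p q : ℕ) :
    (completeBipartiteGraph (Fin p) (Fin q)).edgeSet.ncard = p * q := by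
  rw [Set.ncard, encard_edgeSet_completeBipartiteGraph]
  simp

/-- A Ramsey graph contains the target graph, so it has at least as many edges. -/
theorem IsRamseyFor.mul_le_ncard {V : Type*} [Finite V] {G : SimpleGraph V} {s t : ℕ}
    (h : IsRamseyFor G (completeBipartiteGraph (Fin s) (Fin t))) : s * t ≤ G.edgeSet.ncard := by
  obtain ⟨i, ⟨f⟩⟩ := h (fun _ => 0)
  rw [← ncard_edgeSet_completeBipartiteGraph s t]
  have := Nat.card_le_card_of_injective _ (Hom.mapEdgeSet.injective f.toHom f.injective)
  refine this.trans (Set.ncard_le_ncard ?_ (Set.toFinite _))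
  exact edgeSet_mono (EdgeLabeling.labelGraph_le _)

/-! ### Upper bound: double counting -/

/-- Since `q` is at least `2 * s ^ 2`, each ratio `(2q - j) / (q - j)` with `j < s` exceeds `2` by a
factor of at most `1 + 1 / (2s)`, and the `s` errors multiply to at most `exp (1 / 2) ≤ 2`. -/
theorem descFactorial_two_mul_le {q s : ℕ} (hs : 1 ≤ s) (hq : 2 * s ^ 2 ≤ q) :
    ((2 * q).descFactorial s : ℝ) ≤ 2 * 2 ^ s * (q.descFactorial s : ℝ) := by
  have hs0 : (1 : ℝ) ≤ s := by exact_mod_cast hs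
  have hqR : 2 * (s : ℝ) ^ 2 ≤ q := by exact_mod_cast hq
  have key : ∀ j ≤ s, ((2 * q).descFactorial j : ℝ)
      ≤ (1 + 1 / (2 * s : ℝ)) ^ j * 2 ^ j * (q.descFactorial j : ℝ) := by
    intro j
    induction j with
    | zero => simp
    | succ j ih =>
      intro hj
      have hjs : (j : ℝ) + 1 ≤ s := by exact_mod_cast hj
      have hjq : j ≤ q := by nlinarith
      rw [Nat.descFactorial_succ, Nat.descFactorial_succ, Nat.cast_mul, Nat.cast_mul,
        Nat.cast_sub hjq, Nat.cast_sub (by omega), pow_succ, pow_succ]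
      have h1 : ((2 * q : ℕ) : ℝ) - j ≤ (1 + 1 / (2 * s : ℝ)) * 2 * ((q : ℝ) - j) := by
        have : 1 / (2 * s : ℝ) * 2 * ((q : ℝ) - j) = ((q : ℝ) - j) / s := by field_simp
        have h2 : (j : ℝ) ≤ ((q : ℝ) - j) / s := by
          rw [le_div_iff₀ (by linarith)]
          nlinarith [Nat.cast_nonneg (α := ℝ) j]
        push_cast
        nlinarith
      have h0 : (0 : ℝ) ≤ ((2 * q : ℕ) : ℝ) - j := by
        have : (j : ℝ) ≤ q := by exact_mod_cast hjq
        push_cast; linarith [Nat.cast_nonneg (α := ℝ) q]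
      calc _ ≤ ((1 + 1 / (2 * s : ℝ)) * 2 * ((q : ℝ) - j)) *
            ((1 + 1 / (2 * s : ℝ)) ^ j * 2 ^ j * (q.descFactorial j : ℝ)) :=
            mul_le_mul h1 (ih (by omega)) (by positivity) (h0.trans h1)
        _ = _ := by ring
  refine (key s le_rfl).trans ?_
  gcongr
  have h1 : (1 + 1 / (2 * s : ℝ)) ^ s ≤ Real.exp (1 / 2) := by
    calc (1 + 1 / (2 * s : ℝ)) ^ s ≤ (Real.exp (1 / (2 * s : ℝ))) ^ s := by
          gcongr
          linarith [Real.add_one_le_exp (1 / (2 * s : ℝ))]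
      _ = Real.exp (1 / 2) := by
          rw [← Real.exp_nat_mul]
          congr 1
          field_simp
  refine h1.trans ?_
  have h2 : Real.exp (1 / 2) ^ 2 = Real.exp 1 := by
    rw [← Real.exp_nat_mul]; norm_num
  nlinarith [Real.exp_one_lt_d9, Real.exp_pos (1 / 2 : ℝ)]

theorem choose_two_mul_le {q s : ℕ} (hs : 1 ≤ s) (hq : 2 * s ^ 2 ≤ q) :
    (2 * q).choose s ≤ 2 * 2 ^ s * q.choose s := by
  have h := descFactorial_two_mul_le hs hq
  rw [Nat.descFactorial_eq_factorial_mul_choose, Nat.descFactorial_eq_factorial_mul_choose] at h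
  have h' : s.factorial * (2 * q).choose s ≤ s.factorial * (2 * 2 ^ s * q.choose s) := by
    have : ((s.factorial * (2 * q).choose s : ℕ) : ℝ)
      ≤ ((s.factorial * (2 * 2 ^ s * q.choose s) : ℕ) : ℝ) := by
      push_cast at h ⊢
      linarith
    exact_mod_cast this
  exact Nat.le_of_mul_le_mul_left h' (Nat.factorial_pos s)

/-- If each of `4 t 2 ^ s` subsets of a `2q`-set has at least `q` elements for one of two colors,
then `t` of them share an `s`-set in a common color. -/
theorem isRamseyFor_completeBipartiteGraph {q s t : ℕ} (hs : 1 ≤ s) (hq : 2 * s ^ 2 ≤ q) :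
    IsRamseyFor (completeBipartiteGraph (Fin (2 * q)) (Fin (4 * t * 2 ^ s)))
      (completeBipartiteGraph (Fin s) (Fin t)) := by
  classical
  intro χ
  let N : Fin 2 → Fin (4 * t * 2 ^ s) → Finset (Fin (2 * q)) := fun i b =>
    {a | (χ.labelGraph i).Adj (.inl a) (.inr b)}
  have hN : ∀ b, ∃ i, q ≤ #(N i b) := by
    intro b
    by_contra! hlt
    have hcov : (univ : Finset (Fin (2 * q))) ⊆ N 0 b ∪ N 1 b := by
      intro a _
      have hadj : (completeBipartiteGraph (Fin (2 * q)) (Fin (4 * t * 2 ^ s))).Adj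
        (.inl a) (.inr b) := by simp
      simp only [N, mem_union, mem_filter, mem_univ, true_and, EdgeLabeling.labelGraph_adj]
      generalize hx : χ ⟨s(.inl a, .inr b), hadj⟩ = x
      fin_cases x
      · exact Or.inl ⟨hadj, hx⟩
      · exact Or.inr ⟨hadj, hx⟩
    have h1 := (card_le_card hcov).trans (card_union_le _ _)
    simp only [card_univ, Fintype.card_fin] at h1
    have h2 := hlt 0
    have h3 := hlt 1
    omega
  choose f hf using hN
  obtain ⟨i, hi⟩ : ∃ i, 2 * t * 2 ^ s ≤ #{b | f b = i} := by
    by_contra! hlt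
    have h1 : ∑ i, #{b | f b = i} = 4 * t * 2 ^ s := by
      rw [← card_eq_sum_card_fiberwise (f := f) (t := univ) (by simp)]
      simp
    rw [Fin.sum_univ_two] at h1
    have h2 := hlt 0
    have h3 := hlt 1
    have : 4 * t * 2 ^ s = 2 * t * 2 ^ s + 2 * t * 2 ^ s := by ring
    omega
  refine ⟨i, ?_⟩
  -- Averaging: if every `s`-set lay in fewer than `t` of the sets `N i b`, counting incidences both
  -- ways would contradict `choose_two_mul_le`.
  obtain ⟨S, hS, hSt⟩ : ∃ S ∈ powersetCard s (univ : Finset (Fin (2 * q))),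
      t ≤ #{b | S ⊆ N i b} := by
    by_contra! hlt
    have hdc : ∑ S ∈ powersetCard s (univ : Finset (Fin (2 * q))), #{b | S ⊆ N i b}
        = ∑ b, (#(N i b)).choose s := by
      have := sum_card_bipartiteAbove_eq_sum_card_bipartiteBelow
        (s := powersetCard s (univ : Finset (Fin (2 * q)))) (t := univ)
        (fun S b => S ⊆ N i b)
      refine this.trans (sum_congr rfl fun b _ => ?_)
      rw [← card_powersetCard]
      congr 1
      ext S
      simp [bipartiteBelow, mem_powersetCard, and_comm]
    have hlow : 2 * t * 2 ^ s * q.choose s ≤ ∑ b, (#(N i b)).choose s := by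
      calc 2 * t * 2 ^ s * q.choose s ≤ #{b | f b = i} * q.choose s := Nat.mul_le_mul_right _ hi
        _ = ∑ b with f b = i, q.choose s := by simp
        _ ≤ ∑ b with f b = i, (#(N i b)).choose s := by
            refine sum_le_sum fun b hb => Nat.choose_le_choose _ ?_
            rw [mem_filter] at hb
            exact hb.2 ▸ hf b
        _ ≤ _ := sum_le_sum_of_subset (filter_subset _ _)
    have hne : (powersetCard s (univ : Finset (Fin (2 * q)))).Nonempty := by
      rw [powersetCard_nonempty]
      simp only [card_univ, Fintype.card_fin]
      nlinarith
    have hup := sum_lt_sum_of_nonempty hne hlt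
    rw [hdc, sum_const, card_powersetCard, card_univ, Fintype.card_fin, smul_eq_mul] at hup
    have := choose_two_mul_le hs hq
    have h3 : (2 * q).choose s * t ≤ 2 * 2 ^ s * q.choose s * t := Nat.mul_le_mul_right _ this
    have h4 : 2 * 2 ^ s * q.choose s * t = 2 * t * 2 ^ s * q.choose s := by ring
    omega
  obtain ⟨T, hT, hTt⟩ := exists_subset_card_eq hSt
  rw [completeBipartiteGraph_isContained_iff]
  refine ⟨S.map .inl, T.map .inr, by simpa using (mem_powersetCard.1 hS).2, by simpa using hTt, ?_⟩
  intro x hx y hy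
  simp only [coe_map, Set.mem_image, mem_coe] at hx hy
  obtain ⟨a, ha, rfl⟩ := hx
  obtain ⟨b, hb, rfl⟩ := hy
  have h1 := (mem_filter.1 (hT hb)).2 ha
  exact (mem_filter.1 h1).2

/-! ### Random halves: estimates for `halfRatio` -/

/-- The probability that a fixed `j`-subset of a `d`-set lies in a uniformly random subset of size
`⌈d / 2⌉`. -/
noncomputable def halfRatio (d j : ℕ) : ℝ :=
  ((d - d / 2).descFactorial j : ℝ) / (d.descFactorial j : ℝ)

theorem halfRatio_nonneg (d j : ℕ) : 0 ≤ halfRatio d j := by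
  unfold halfRatio; positivity

theorem halfRatio_zero (d : ℕ) : halfRatio d 0 = 1 := by
  simp [halfRatio]

theorem halfRatio_succ (d j : ℕ) :
    halfRatio d (j + 1) = ((d - d / 2 - j : ℕ) : ℝ) / ((d - j : ℕ) : ℝ) * halfRatio d j := by
  unfold halfRatio
  rw [Nat.descFactorial_succ, Nat.descFactorial_succ, Nat.cast_mul, Nat.cast_mul, mul_div_mul_comm]

theorem two_mul_halfRatio_one_le (d : ℕ) : 2 * halfRatio d 1 ≤ 2 := by
  rw [halfRatio_succ, halfRatio_zero]
  have : ((d - d / 2 - 0 : ℕ) : ℝ) / ((d - 0 : ℕ) : ℝ) ≤ 1 := by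
    apply div_le_one_of_le₀ _ (by positivity)
    exact_mod_cast (by omega)
  linarith

/-- Drawing without replacement, the factor for the draw after `j + 1` successes is at most `1 / 2`
divided by `1 + j / d`. The product of these savings is at least one plus their sum, which is the
quadratic term here. The `2` on the right pays for rounding in the first factor, which is `1` when
`d = 1`. -/
theorem halfRatio_succ_bound (j : ℕ) {d : ℕ} (hj : j + 1 ≤ d) :
    2 ^ (j + 1) * halfRatio d (j + 1) * (1 + (j : ℝ) * ((j : ℝ) - 1) / (2 * d)) ≤ 2 := by
  induction j with
  | zero => simpa using two_mul_halfRatio_one_le d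
  | succ j ih =>
    have ih := ih (by omega)
    have hd : (0 : ℝ) < d := by exact_mod_cast (by omega)
    have hjd : (j : ℝ) + 2 ≤ d := by exact_mod_cast hj
    have hj0 : (0 : ℝ) ≤ j := Nat.cast_nonneg j
    have hg : 0 ≤ (j : ℝ) * ((j : ℝ) - 1) / (2 * d) := by
      apply div_nonneg _ (by positivity)
      rcases j with _ | j
      · simp
      · push_cast
        nlinarith [Nat.cast_nonneg (α := ℝ) j]
    set F : ℝ := ((d - d / 2 - (j + 1) : ℕ) : ℝ) / ((d - (j + 1) : ℕ) : ℝ) with hF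
    have hF0 : 0 ≤ F := by positivity
    -- After clearing denominators this is `(d - 1 - 2j)(d + j) ≤ (d - j - 1) d`; the case split
    -- handles truncated subtraction.
    have hFx : 2 * F * (1 + (j : ℝ) / d) ≤ 1 := by
      rw [hF, Nat.cast_sub (by omega : j + 1 ≤ d)]
      push_cast
      have hden : (0 : ℝ) < (d : ℝ) - (j + 1) := by linarith
      rcases le_or_gt (d - d / 2) (j + 1) with h | h
      · simp [Nat.sub_eq_zero_of_le h]
      · have h2 : 2 * ((d - d / 2 - (j + 1) : ℕ) : ℝ) ≤ (d : ℝ) - 1 - 2 * j := by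
          have : 2 * (d - d / 2 - (j + 1)) + 1 + 2 * j ≤ d := by omega
          have : ((2 * (d - d / 2 - (j + 1)) + 1 + 2 * j : ℕ) : ℝ) ≤ d := by exact_mod_cast this
          push_cast at this
          linarith
        have h3 : 2 * (((d - d / 2 - (j + 1) : ℕ) : ℝ) / ((d : ℝ) - (j + 1))) * (1 + (j : ℝ) / d)
            = (2 * ((d - d / 2 - (j + 1) : ℕ) : ℝ)) * (d + j) / (((d : ℝ) - (j + 1)) * d) := by
          field_simp
        rw [h3, div_le_one (by positivity)]
        nlinarith [mul_le_mul_of_nonneg_right h2 (by positivity : (0 : ℝ) ≤ d + j)]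
    have hstep : 2 * F * (1 + ((j + 1 : ℕ) : ℝ) * (((j + 1 : ℕ) : ℝ) - 1) / (2 * d))
        ≤ 1 + (j : ℝ) * ((j : ℝ) - 1) / (2 * d) := by
      have h1 : ((j + 1 : ℕ) : ℝ) * (((j + 1 : ℕ) : ℝ) - 1) / (2 * d)
          = (j : ℝ) * ((j : ℝ) - 1) / (2 * d) + (j : ℝ) / d := by
        push_cast
        field_simp
        ring
      rw [h1]
      have h2 : 0 ≤ (j : ℝ) / d := by positivity
      nlinarith [mul_le_mul_of_nonneg_right hFx
        (by linarith : 0 ≤ 1 + (j : ℝ) * ((j : ℝ) - 1) / (2 * d)),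
        mul_nonneg hF0 (mul_nonneg hg h2)]
    rw [halfRatio_succ, ← hF]
    calc 2 ^ (j + 1 + 1) * (F * halfRatio d (j + 1)) *
          (1 + ((j + 1 : ℕ) : ℝ) * (((j + 1 : ℕ) : ℝ) - 1) / (2 * d))
        = 2 ^ (j + 1) * halfRatio d (j + 1) *
          (2 * F * (1 + ((j + 1 : ℕ) : ℝ) * (((j + 1 : ℕ) : ℝ) - 1) / (2 * d))) := by ring
      _ ≤ 2 ^ (j + 1) * halfRatio d (j + 1) * (1 + (j : ℝ) * ((j : ℝ) - 1) / (2 * d)) := by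
          have := halfRatio_nonneg d (j + 1)
          gcongr
      _ ≤ 2 := ih

/-- The denominator vanishes too, and the convention `x / 0 = 0` gives the correct probability. -/
theorem halfRatio_eq_zero {d j : ℕ} (h : d < j) : halfRatio d j = 0 := by
  simp [halfRatio, Nat.descFactorial_of_lt h]

theorem halfRatio_le (d j : ℕ) : halfRatio d j ≤ 2 * (1 / 2) ^ j := by
  rcases lt_or_ge d j with h | h
  · rw [halfRatio_eq_zero h]; positivity
  rcases j with _ | j
  · simp [halfRatio_zero]
  have hb := halfRatio_succ_bound j h
  have hg : 0 ≤ (j : ℝ) * ((j : ℝ) - 1) / (2 * d) := by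
    apply div_nonneg _ (by positivity)
    rcases j with _ | j
    · simp
    · push_cast
      nlinarith [Nat.cast_nonneg (α := ℝ) j]
  have h0 : 0 ≤ 2 ^ (j + 1) * halfRatio d (j + 1) :=
    mul_nonneg (by positivity) (halfRatio_nonneg _ _)
  have h1 : 2 ^ (j + 1) * halfRatio d (j + 1) ≤ 2 := by nlinarith
  rw [one_div, inv_pow, ← div_eq_mul_inv, le_div_iff₀ (by positivity)]
  linarith

theorem halfRatio_le_mul_div {s : ℕ} (hs : 4 ≤ s) (d : ℕ) :
    halfRatio d s ≤ 16 * (1 / 2) ^ s * (d / (s : ℝ) ^ 2) := by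
  rcases lt_or_ge d s with h | h
  · rw [halfRatio_eq_zero h]; positivity
  obtain ⟨j, rfl⟩ : ∃ j, s = j + 1 := ⟨s - 1, by omega⟩
  have hb := halfRatio_succ_bound j h
  have hd : (0 : ℝ) < d := by exact_mod_cast (by omega)
  have hj : (3 : ℝ) ≤ j := by exact_mod_cast (by omega)
  set x := 2 ^ (j + 1) * halfRatio d (j + 1) with hx
  have h0 : 0 ≤ x := mul_nonneg (by positivity) (halfRatio_nonneg _ _)
  have h1 : x * (((j : ℝ) + 1) ^ 2 / (8 * d)) ≤ 2 := by
    refine le_trans (mul_le_mul_of_nonneg_left ?_ h0) hb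
    -- This is `(j + 1) ^ 2 ≤ 4 j (j - 1)`, which fails at `j = 2`; hence `4 ≤ s`.
    have : ((j : ℝ) + 1) ^ 2 / (8 * d) ≤ (j : ℝ) * ((j : ℝ) - 1) / (2 * d) := by
      rw [div_le_div_iff₀ (by positivity) (by positivity)]
      nlinarith [mul_nonneg hd.le (by nlinarith : 0 ≤ 4 * ((j : ℝ) * (j - 1)) - ((j : ℝ) + 1) ^ 2)]
    linarith
  have h2 : x ≤ 16 * (d / ((j + 1 : ℕ) : ℝ) ^ 2) := by
    push_cast
    rw [← mul_div_assoc, le_div_iff₀ (by positivity)]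
    rw [← mul_div_assoc, div_le_iff₀ (by positivity)] at h1
    linarith
  have h3 : halfRatio d (j + 1) = (1 / 2) ^ (j + 1) * x := by
    rw [hx, ← mul_assoc, ← mul_pow]; norm_num
  rw [h3]
  calc _ ≤ (1 / 2 : ℝ) ^ (j + 1) * (16 * (d / ((j + 1 : ℕ) : ℝ) ^ 2)) := by gcongr
    _ = _ := by ring

/-! ### Counting the subsets of fixed size that contain or avoid a given set -/

theorem card_filter_subset_powersetCard_le {α : Type*} [DecidableEq α] {N A : Finset α}
    (hA : A ⊆ N) (r : ℕ) :
    (#{B ∈ powersetCard r N | A ⊆ B} : ℝ)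
      ≤ (r.descFactorial #A : ℝ) / ((#N).descFactorial #A : ℝ) * ((#N).choose r : ℝ) := by
  rcases lt_or_ge r #A with h | h
  · have : {B ∈ powersetCard r N | A ⊆ B} = ∅ := by
      refine filter_eq_empty_iff.2 fun B hB hAB => ?_
      have := card_le_card hAB
      rw [(mem_powersetCard.1 hB).2] at this
      omega
    rw [this]
    simp only [card_empty, Nat.cast_zero]
    positivity
  have h1 : #{B ∈ powersetCard r N | A ⊆ B} ≤ (#N - #A).choose (r - #A) := by
    rw [← card_sdiff_of_subset hA, ← card_powersetCard]
    refine card_le_card_of_injOn (fun B => B \ A) ?_ ?_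
    · intro B hB
      simp only [coe_filter, Set.mem_ofPred_eq, mem_powersetCard] at hB
      simp only [mem_coe, mem_powersetCard]
      exact ⟨sdiff_subset_sdiff hB.1.1 subset_rfl, by rw [card_sdiff_of_subset hB.2, hB.1.2]⟩
    · intro B hB C hC hBC
      simp only [coe_filter, Set.mem_ofPred_eq] at hB hC
      rw [← sdiff_union_of_subset hB.2, ← sdiff_union_of_subset hC.2]
      exact congrArg (· ∪ A) hBC
  have h2 := Nat.choose_mul (n := #N) h
  have h3 : 0 < (#N).choose #A := Nat.choose_pos (card_le_card hA)
  rw [Nat.descFactorial_eq_factorial_mul_choose, Nat.descFactorial_eq_factorial_mul_choose,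
    Nat.cast_mul, Nat.cast_mul, mul_div_mul_left _ _ (by positivity), div_mul_eq_mul_div,
    le_div_iff₀ (by exact_mod_cast h3)]
  have h4 : #{B ∈ powersetCard r N | A ⊆ B} * (#N).choose #A
      ≤ r.choose #A * (#N).choose r := by
    calc _ ≤ (#N - #A).choose (r - #A) * (#N).choose #A := Nat.mul_le_mul_right _ h1
      _ = _ := by rw [mul_comm, ← h2, mul_comm]
  exact_mod_cast h4

theorem card_filter_disjoint_powersetCard_le {α : Type*} [DecidableEq α] {N A : Finset α}
    (hA : A ⊆ N) (r : ℕ) :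
    #{B ∈ powersetCard r N | Disjoint A B} ≤ #{B ∈ powersetCard (#N - r) N | A ⊆ B} := by
  refine card_le_card_of_injOn (fun B => N \ B) ?_ ?_
  · intro B hB
    simp only [coe_filter, Set.mem_ofPred_eq, mem_powersetCard] at hB ⊢
    refine ⟨⟨sdiff_subset, by rw [card_sdiff_of_subset hB.1.1, hB.1.2]⟩, ?_⟩
    exact subset_sdiff.2 ⟨hA, hB.2⟩
  · intro B hB C hC hBC
    simp only [coe_filter, Set.mem_ofPred_eq, mem_powersetCard] at hB hC
    rw [← Finset.sdiff_sdiff_eq_self hB.1.1, ← Finset.sdiff_sdiff_eq_self hC.1.1]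
    exact congrArg (N \ ·) hBC

/-- `A` lies entirely on the side of `B` that carries the color `i`: inside `B` for color `0` and
outside `B` for color `1`. -/
def OnSide {α : Type*} (i : Fin 2) (A B : Finset α) : Prop :=
  if i = 0 then A ⊆ B else Disjoint A B

-- The chosen half has `⌊#N / 2⌋` elements and its complement `⌈#N / 2⌉`. Avoiding `A` means that
-- the complement contains `A`, so the rounded-up ratio bounds both colors.
open Classical in
theorem card_filter_onSide_powersetCard_le {α : Type*} {N A : Finset α}
    (hA : A ⊆ N) (i : Fin 2) :
    (#{B ∈ powersetCard (#N / 2) N | OnSide i A B} : ℝ)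
      ≤ halfRatio #N #A * (#(powersetCard (#N / 2) N) : ℝ) := by
  have hmono : ∀ r ≤ #N - #N / 2, (r.descFactorial #A : ℝ) / ((#N).descFactorial #A : ℝ)
      ≤ halfRatio #N #A := by
    intro r hr
    unfold halfRatio
    gcongr
  rw [card_powersetCard]
  by_cases hi : i = 0
  · simp only [OnSide, hi, if_true]
    refine (card_filter_subset_powersetCard_le hA _).trans ?_
    gcongr
    exact hmono _ (by omega)
  · simp only [OnSide, hi, if_false]
    have h1 : (#{B ∈ powersetCard (#N / 2) N | Disjoint A B} : ℝ)
        ≤ (#{B ∈ powersetCard (#N - #N / 2) N | A ⊆ B} : ℝ) := by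
      exact_mod_cast card_filter_disjoint_powersetCard_le hA _
    refine h1.trans ((card_filter_subset_powersetCard_le hA _).trans ?_)
    rw [Nat.choose_symm (by omega)]
    gcongr
    exact hmono _ le_rfl

open Classical in
theorem card_filter_onSide_univ {α : Type*} [Fintype α] (A : Finset α) (i : Fin 2) :
    (#{B : Finset α | OnSide i A B} : ℝ) = (1 / 2) ^ #A * (Fintype.card (Finset α) : ℝ) := by
  have key : #{B : Finset α | OnSide i A B} = 2 ^ (Fintype.card α - #A) := by
    rw [← card_compl, ← card_powerset]
    by_cases hi : i = 0
    · refine card_bij (fun B _ => Bᶜ) ?_ ?_ ?_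
      · intro B hB
        simpa [OnSide, hi] using hB
      · intro B _ C _ h
        exact compl_injective h
      · intro C hC
        exact ⟨Cᶜ, by simpa [OnSide, hi, subset_compl_comm] using hC, compl_compl C⟩
    · congr 1
      ext B
      simp [OnSide, hi, subset_compl_iff_disjoint_left]
  rw [key, Fintype.card_finset]
  have := pow_sub₀ (2 : ℝ) two_ne_zero (card_le_univ A)
  push_cast
  rw [this, one_div, inv_pow, mul_comm]

/-! ### The random coloring and the probability of a monochromatic pair -/

section RandomColoring

open scoped Classical

variable {V : Type*} [Fintype V] (G : SimpleGraph V) (D : ℕ)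

/-- The neighbors of `v` of degree at least `D`. -/
noncomputable def highNeighbors (v : V) : Finset V := {u ∈ G.neighborFinset v | D ≤ G.degree u}

/-- The sample space of the random coloring: for every vertex a subset containing half of its
neighbors of high degree, and a set of pairs of vertices. -/
noncomputable def colorSpace : Finset ((V → Finset V) × Finset (Sym2 V)) :=
  Fintype.piFinset
    (fun v => powersetCard (#(highNeighbors G D v) / 2) (highNeighbors G D v)) ×ˢ univ

/-- An edge from a vertex `u` of low degree to a vertex `v` of high degree is red if `v` is in the
chosen half of the high neighbors of `u`; any other edge is red if it is a chosen pair. -/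
def IsRed (ω : (V → Finset V) × Finset (Sym2 V)) (u v : V) : Prop :=
  if G.degree u < D ∧ D ≤ G.degree v then v ∈ ω.1 u
  else if G.degree v < D ∧ D ≤ G.degree u then u ∈ ω.1 v
  else s(u, v) ∈ ω.2

theorem isRed_comm (ω : (V → Finset V) × Finset (Sym2 V)) (u v : V) :
    IsRed G D ω u v ↔ IsRed G D ω v u := by
  unfold IsRed
  rw [Sym2.eq_swap]
  split_ifs <;> first | rfl | omega

/-- The edge labeling given by `IsRed`. -/
noncomputable def redLabeling (ω : (V → Finset V) × Finset (Sym2 V)) : G.EdgeLabeling (Fin 2) :=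
  EdgeLabeling.mk (fun u v _ => if IsRed G D ω u v then 0 else 1)
    (fun u v _ => by simp only [isRed_comm G D ω u v])

theorem redLabeling_labelGraph_adj {ω : (V → Finset V) × Finset (Sym2 V)} {i : Fin 2} {u v : V} :
    ((redLabeling G D ω).labelGraph i).Adj u v ↔ G.Adj u v ∧ (IsRed G D ω u v ↔ i = 0) := by
  rw [EdgeLabeling.labelGraph_adj]
  have : ∀ h : G.Adj u v, (redLabeling G D ω) ⟨s(u, v), h⟩
    = if IsRed G D ω u v then 0 else 1 := fun h => rfl
  simp only [this, exists_prop]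
  refine and_congr_right fun _ => ?_
  split_ifs with h <;> fin_cases i <;> simp [h]

theorem colorSpace_card_pos : 0 < #(colorSpace G D) := by
  rw [card_pos, colorSpace, nonempty_product, Fintype.piFinset_nonempty]
  refine ⟨fun v => powersetCard_nonempty.2 (by omega), univ_nonempty⟩

theorem card_filter_onSide_colorSpace_le {A : V → Finset V} (hA : ∀ v, A v ⊆ highNeighbors G D v)
    (E : Finset (Sym2 V)) (i : Fin 2) :
    (#{ω ∈ colorSpace G D | (∀ v, OnSide i (A v) (ω.1 v)) ∧ OnSide i E ω.2} : ℝ)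
      ≤ (∏ v, halfRatio #(highNeighbors G D v) #(A v)) * (1 / 2) ^ #E * #(colorSpace G D) := by
  have h : {ω ∈ colorSpace G D | (∀ v, OnSide i (A v) (ω.1 v)) ∧ OnSide i E ω.2}
      = Fintype.piFinset (fun v => {B ∈ powersetCard (#(highNeighbors G D v) / 2)
          (highNeighbors G D v) | OnSide i (A v) B}) ×ˢ
        ({F : Finset (Sym2 V) | OnSide i E F} : Finset (Finset (Sym2 V))) := by
    ext ω
    simp only [colorSpace, mem_filter, mem_product, Fintype.mem_piFinset, mem_univ, true_and,
      and_true, forall_and, and_assoc]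
  rw [h, card_product, Fintype.card_piFinset, colorSpace, card_product, Fintype.card_piFinset,
    Nat.cast_mul, Nat.cast_mul, Nat.cast_prod, Nat.cast_prod, card_univ, card_filter_onSide_univ]
  calc _ ≤ (∏ v, (halfRatio #(highNeighbors G D v) #(A v) *
        (#(powersetCard (#(highNeighbors G D v) / 2) (highNeighbors G D v)) : ℝ))) *
        ((1 / 2) ^ #E * (Fintype.card (Finset (Sym2 V)) : ℝ)) := by
        gcongr with v _
        exact card_filter_onSide_powersetCard_le (hA v) i
    _ = _ := by rw [prod_mul_distrib]; ring

/-- The outcomes for which all pairs in `S × T` are edges of color `i`. -/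
noncomputable def monoEvent (i : Fin 2) (S T : Finset V) :
    Finset ((V → Finset V) × Finset (Sym2 V)) :=
  {ω ∈ colorSpace G D | ∀ u ∈ S, ∀ v ∈ T, ((redLabeling G D ω).labelGraph i).Adj u v}

/-- Edges between a low and a high vertex are decided by the half chosen at the low end, the others
by the random set of pairs. All these choices are independent, so the probability factors. -/
theorem card_monoEvent_le (i : Fin 2) (S T : Finset V) :
    (#(monoEvent G D i S T) : ℝ) ≤
      (∏ v ∈ T with G.degree v < D, halfRatio #(highNeighbors G D v) #{u ∈ S | D ≤ G.degree u}) *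
      (∏ u ∈ S with G.degree u < D, halfRatio #(highNeighbors G D u) #{v ∈ T | D ≤ G.degree v}) *
      (1 / 2) ^ (#{u ∈ S | G.degree u < D} * #{v ∈ T | G.degree v < D}
        + #{u ∈ S | D ≤ G.degree u} * #{v ∈ T | D ≤ G.degree v}) * #(colorSpace G D) := by
  -- A single outcome in the event already shows that all of `S × T` consists of edges of `G`, so
  -- `S` and `T` are disjoint.
  rcases (monoEvent G D i S T).eq_empty_or_nonempty with h0 | ⟨ω₀, hω₀⟩
  · rw [h0, card_empty, Nat.cast_zero]
    have := fun v (F : Finset V) => halfRatio_nonneg #(highNeighbors G D v) #F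
    have h1 := prod_nonneg (s := {v ∈ T | G.degree v < D})
      fun v _ => this v {u ∈ S | D ≤ G.degree u}
    have h2 := prod_nonneg (s := {u ∈ S | G.degree u < D})
      fun v _ => this v {u ∈ T | D ≤ G.degree u}
    positivity
  have hadj : ∀ u ∈ S, ∀ v ∈ T, G.Adj u v := fun u hu v hv =>
    ((redLabeling_labelGraph_adj G D).1 ((mem_filter.1 hω₀).2 u hu v hv)).1
  have hdisj : ∀ u ∈ S, u ∉ T := fun u hu hu' => (hadj u hu u hu').ne rfl
  set SL := {u ∈ S | G.degree u < D} with hSL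
  set TL := {v ∈ T | G.degree v < D} with hTL
  set SH := {u ∈ S | D ≤ G.degree u} with hSH
  set TH := {v ∈ T | D ≤ G.degree v} with hTH
  -- `A v` collects the high vertices opposite a low vertex `v`; `E` collects the low-low and
  -- high-high pairs.
  let A : V → Finset V := fun v => if v ∈ TL then SH else if v ∈ SL then TH else ∅
  let E : Finset (Sym2 V) := (SL ×ˢ TL ∪ SH ×ˢ TH).image (fun p => s(p.1, p.2))
  have hA : ∀ v, A v ⊆ highNeighbors G D v := by
    intro v w hw
    simp only [A] at hw
    rw [highNeighbors, mem_filter, mem_neighborFinset]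
    split_ifs at hw with h1 h2
    · exact ⟨(hadj w (mem_filter.1 hw).1 v (mem_filter.1 h1).1).symm, (mem_filter.1 hw).2⟩
    · exact ⟨hadj v (mem_filter.1 h2).1 w (mem_filter.1 hw).1, (mem_filter.1 hw).2⟩
    · simp at hw
  have hE : #E = #SL * #TL + #SH * #TH := by
    rw [card_image_of_injOn, card_union_of_disjoint, card_product, card_product]
    · rw [Finset.disjoint_left]
      rintro ⟨a, b⟩ h1 h2
      have h3 := (mem_filter.1 (mem_product.1 h1).1).2
      have h4 := (mem_filter.1 (mem_product.1 h2).1).2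
      simp only at h3 h4
      omega
    · have hsub : ∀ p ∈ SL ×ˢ TL ∪ SH ×ˢ TH, p.1 ∈ S ∧ p.2 ∈ T := by
        intro p hp
        simp only [hSL, hTL, hSH, hTH, mem_union, mem_product, mem_filter] at hp
        tauto
      intro p hp q hq hpq
      obtain ⟨hp1, hp2⟩ := hsub p hp
      obtain ⟨hq1, hq2⟩ := hsub q hq
      simp only [Sym2.eq_iff] at hpq
      rcases hpq with h | h
      · exact Prod.ext h.1 h.2
      · exact absurd (h.1 ▸ hq2) (hdisj _ hp1)
  have hprod : ∏ v, halfRatio #(highNeighbors G D v) #(A v)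
      = (∏ v ∈ TL, halfRatio #(highNeighbors G D v) #SH) *
        ∏ u ∈ SL, halfRatio #(highNeighbors G D u) #TH := by
    have hd : Disjoint TL SL := by
      rw [Finset.disjoint_left]
      exact fun v h1 h2 => hdisj v (mem_filter.1 h2).1 (mem_filter.1 h1).1
    have h1 : ∏ v ∈ TL, halfRatio #(highNeighbors G D v) #SH
        = ∏ v ∈ TL, halfRatio #(highNeighbors G D v) #(A v) :=
      prod_congr rfl fun v hv => by simp only [A, hv, if_true]
    have h2 : ∏ v ∈ SL, halfRatio #(highNeighbors G D v) #TH
        = ∏ v ∈ SL, halfRatio #(highNeighbors G D v) #(A v) :=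
      prod_congr rfl fun v hv => by
        simp only [A, hv, if_true, Finset.disjoint_right.1 hd hv, if_false]
    rw [h1, h2, ← prod_union hd]
    refine (prod_subset (subset_univ _) fun v _ hv => ?_).symm
    rw [mem_union, not_or] at hv
    simp only [A, hv.1, hv.2, if_false, card_empty, halfRatio_zero]
  have hmain := card_filter_onSide_colorSpace_le G D hA E i
  rw [hprod, hE] at hmain
  refine le_trans ?_ hmain
  norm_cast
  refine card_le_card fun ω hω => ?_
  rw [monoEvent, mem_filter] at hω
  rw [mem_filter]
  have hred : ∀ u ∈ S, ∀ v ∈ T, (IsRed G D ω u v ↔ i = 0) := fun u hu v hv =>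
    ((redLabeling_labelGraph_adj G D).1 (hω.2 u hu v hv)).2
  have hside : ∀ {α : Type _} (X Y : Finset α), (∀ x ∈ X, (x ∈ Y ↔ i = 0)) → OnSide i X Y := by
    intro α X Y h
    unfold OnSide
    split_ifs with hi
    · exact fun x hx => (h x hx).2 hi
    · exact Finset.disjoint_left.2 fun x hx hy => hi ((h x hx).1 hy)
  refine ⟨hω.1, fun v => hside _ _ fun w hw => ?_, hside _ _ fun e he => ?_⟩
  · simp only [A] at hw
    split_ifs at hw with h1 h2
    · have := hred w (mem_filter.1 hw).1 v (mem_filter.1 h1).1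
      rw [isRed_comm, IsRed, if_pos ⟨(mem_filter.1 h1).2, (mem_filter.1 hw).2⟩] at this
      exact this
    · have := hred v (mem_filter.1 h2).1 w (mem_filter.1 hw).1
      rw [IsRed, if_pos ⟨(mem_filter.1 h2).2, (mem_filter.1 hw).2⟩] at this
      exact this
    · simp at hw
  · obtain ⟨⟨u, v⟩, hp, rfl⟩ := mem_image.1 he
    simp only [hSL, hTL, hSH, hTH, mem_union, mem_product, mem_filter] at hp
    have := hred u (by tauto) v (by tauto)
    rw [IsRed, if_neg (by omega), if_neg (by omega)] at this
    exact this

/-- Each low vertex loses at most a factor `2` against a uniform coloring, by `halfRatio_le`. -/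
theorem card_monoEvent_le_pow (i : Fin 2) (S T : Finset V) :
    (#(monoEvent G D i S T) : ℝ)
      ≤ 2 ^ (#S + #T) * (1 / 2) ^ (#S * #T) * #(colorSpace G D) := by
  refine (card_monoEvent_le G D i S T).trans ?_
  have hS := card_filter_add_card_filter_not (s := S) (fun u => G.degree u < D)
  have hT := card_filter_add_card_filter_not (s := T) (fun u => G.degree u < D)
  simp only [not_lt] at hS hT
  set a := #{u ∈ S | G.degree u < D}
  set b := #{u ∈ S | D ≤ G.degree u}
  set c := #{u ∈ T | G.degree u < D}
  set d := #{u ∈ T | D ≤ G.degree u}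
  have h1 : (∏ v ∈ T with G.degree v < D, halfRatio #(highNeighbors G D v) b)
      ≤ (2 * (1 / 2) ^ b) ^ c :=
    (prod_le_prod (fun _ _ => halfRatio_nonneg _ _) fun _ _ => halfRatio_le _ _).trans_eq
      (by rw [prod_const])
  have h2 : (∏ v ∈ S with G.degree v < D, halfRatio #(highNeighbors G D v) d)
      ≤ (2 * (1 / 2) ^ d) ^ a :=
    (prod_le_prod (fun _ _ => halfRatio_nonneg _ _) fun _ _ => halfRatio_le _ _).trans_eq
      (by rw [prod_const])
  have h2' : 0 ≤ ∏ v ∈ S with G.degree v < D, halfRatio #(highNeighbors G D v) d :=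
    prod_nonneg fun _ _ => halfRatio_nonneg _ _
  calc _ ≤ (2 * (1 / 2) ^ b) ^ c * (2 * (1 / 2) ^ d) ^ a * (1 / 2) ^ (a * c + b * d) *
        (#(colorSpace G D) : ℝ) := by gcongr
    _ = 2 ^ (a + c) * (1 / 2) ^ (#S * #T) * #(colorSpace G D) := by
        rw [← hS, ← hT, mul_pow, mul_pow, ← pow_mul, ← pow_mul]
        ring
    _ ≤ _ := by
        gcongr
        · norm_num
        · omega
        · omega

/-- If all vertices of `S` have high degree, then the probability that `S × T` is monochromatic is
at most a product over `T`, in which vertices of low degree count less. -/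
theorem card_monoEvent_le_prod {s : ℕ} (hs : 4 ≤ s) (i : Fin 2) {S : Finset V} (T : Finset V)
    (hcard : #S = s) (hS : ∀ u ∈ S, s ^ 2 ≤ G.degree u) :
    (#(monoEvent G (s ^ 2) i S T) : ℝ)
      ≤ (∏ v ∈ T, 16 * (1 / 2) ^ s * min 1 ((G.degree v : ℝ) / (s : ℝ) ^ 2)) *
        #(colorSpace G (s ^ 2)) := by
  refine (card_monoEvent_le G (s ^ 2) i S T).trans ?_
  have e1 : {u ∈ S | G.degree u < s ^ 2} = ∅ :=
    filter_eq_empty_iff.2 fun u hu => not_lt.2 (hS u hu)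
  have e2 : {u ∈ S | s ^ 2 ≤ G.degree u} = S := filter_true_of_mem hS
  rw [e1, e2, hcard, prod_empty, mul_one, card_empty, zero_mul, zero_add]
  have hs2 : (0 : ℝ) < (s : ℝ) ^ 2 := by positivity
  gcongr
  rw [← prod_filter_mul_prod_filter_not T (fun v => G.degree v < s ^ 2)]
  simp only [not_lt]
  refine mul_le_mul (prod_le_prod (fun _ _ => halfRatio_nonneg _ _) fun v hv => ?_) ?_
    (by positivity) (prod_nonneg fun v _ => by positivity)
  · refine (halfRatio_le_mul_div hs _).trans ?_
    have h1 : (#(highNeighbors G (s ^ 2) v) : ℝ) ≤ G.degree v := by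
      exact_mod_cast card_le_card (filter_subset _ _)
    have h2 : (G.degree v : ℝ) ≤ (s : ℝ) ^ 2 := by
      exact_mod_cast (mem_filter.1 hv).2.le
    rw [min_eq_right ((div_le_one hs2).2 h2)]
    gcongr
  · rw [pow_mul, ← prod_const]
    refine prod_le_prod (fun _ _ => by positivity) fun v hv => ?_
    have h2 : (s : ℝ) ^ 2 ≤ G.degree v := by exact_mod_cast (mem_filter.1 hv).2
    rw [min_eq_left ((one_le_div hs2).2 h2)]
    have : (0 : ℝ) < (1 / 2) ^ s := by positivity
    linarith

end RandomColoring

/-! ### Union bound over the copies -/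

/-- After scaling by `1 / δ`, the elementary symmetric sum is part of the expansion of `∏ (1 + p v /
δ)`, which is at most `exp (∑ p v / δ) ≤ exp t`. -/
theorem sum_powersetCard_prod_le {ι : Type*} (U : Finset ι) {p : ι → ℝ} (hp : ∀ v, 0 ≤ p v)
    {δ : ℝ} (hδ : 0 < δ) {t : ℕ} (h : ∑ v ∈ U, p v ≤ δ * t) :
    ∑ T ∈ powersetCard t U, ∏ v ∈ T, p v ≤ (Real.exp 1 * δ) ^ t := by
  classical
  have h1 : ∑ T ∈ powersetCard t U, ∏ v ∈ T, (p v / δ) ≤ Real.exp t := by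
    calc ∑ T ∈ powersetCard t U, ∏ v ∈ T, (p v / δ)
        ≤ ∑ T ∈ U.powerset, ∏ v ∈ T, (p v / δ) := by
          refine sum_le_sum_of_subset_of_nonneg ?_ fun T _ _ =>
            prod_nonneg fun v _ => div_nonneg (hp v) hδ.le
          exact fun T hT => mem_powerset.2 (mem_powersetCard.1 hT).1
      _ = ∏ v ∈ U, (1 + p v / δ) := (prod_one_add U).symm
      _ ≤ ∏ v ∈ U, Real.exp (p v / δ) := by
          refine prod_le_prod (fun v _ => ?_) fun v _ => ?_
          · have := div_nonneg (hp v) hδ.le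
            linarith
          · linarith [Real.add_one_le_exp (p v / δ)]
      _ = Real.exp ((∑ v ∈ U, p v) / δ) := by rw [← Real.exp_sum, sum_div]
      _ ≤ Real.exp t := by
          rw [Real.exp_le_exp, div_le_iff₀ hδ]
          linarith
  have h2 : ∑ T ∈ powersetCard t U, ∏ v ∈ T, p v
      = δ ^ t * ∑ T ∈ powersetCard t U, ∏ v ∈ T, (p v / δ) := by
    rw [mul_sum]
    refine sum_congr rfl fun T hT => ?_
    rw [prod_div_distrib, prod_const, (mem_powersetCard.1 hT).2]
    field_simp
  rw [h2, mul_pow, ← Real.exp_nat_mul, mul_one, mul_comm]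
  gcongr

section Counting

open scoped Classical

variable {V : Type*} [Fintype V] (G : SimpleGraph V)

theorem sum_degree_le (U : Finset V) :
    ∑ v ∈ U, (G.degree v : ℝ) ≤ 2 * (#G.edgeFinset : ℝ) := by
  have h : ∑ v ∈ U, G.degree v ≤ 2 * #G.edgeFinset :=
    (sum_le_sum_of_subset (subset_univ _)).trans_eq G.sum_degrees_eq_twice_card_edges
  exact_mod_cast h

theorem mul_card_filter_le_degree (k : ℕ) :
    (k : ℝ) * #{v | k ≤ G.degree v} ≤ 2 * (#G.edgeFinset : ℝ) := by
  refine le_trans ?_ (sum_degree_le G {v | k ≤ G.degree v})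
  rw [mul_comm, ← nsmul_eq_mul]
  refine card_nsmul_le_sum _ (fun v => (G.degree v : ℝ)) (k : ℝ) fun v hv => ?_
  exact_mod_cast (mem_filter.1 hv).2

/-- Pairs `S × T` in which `S` contains a vertex of low degree. -/
theorem sum_monoEvent_low_le {s t : ℕ} (ht : 1 ≤ t) (i : Fin 2) :
    ∑ S ∈ powersetCard s ({v | t ≤ G.degree v} : Finset V),
      ∑ u ∈ S with G.degree u < s ^ 2, ∑ T ∈ powersetCard t (G.neighborFinset u),
        (#(monoEvent G (s ^ 2) i S T) : ℝ)
      ≤ (2 * (#G.edgeFinset : ℝ) / t) ^ s * s * ((s : ℝ) ^ 2) ^ t *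
        (2 ^ (s + t) * (1 / 2) ^ (s * t)) * #(colorSpace G (s ^ 2)) := by
  set C : ℝ := 2 ^ (s + t) * (1 / 2) ^ (s * t) * #(colorSpace G (s ^ 2)) with hC
  have hC0 : 0 ≤ C := by positivity
  have hinner : ∀ S ∈ powersetCard s ({v | t ≤ G.degree v} : Finset V),
      ∑ u ∈ S with G.degree u < s ^ 2, ∑ T ∈ powersetCard t (G.neighborFinset u),
        (#(monoEvent G (s ^ 2) i S T) : ℝ) ≤ s * (((s : ℝ) ^ 2) ^ t * C) := by
    intro S hS
    have hSs := (mem_powersetCard.1 hS).2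
    calc _ ≤ ∑ u ∈ S with G.degree u < s ^ 2, (((s : ℝ) ^ 2) ^ t * C) := by
          refine sum_le_sum fun u hu => ?_
          calc _ ≤ ∑ T ∈ powersetCard t (G.neighborFinset u), C := by
                refine sum_le_sum fun T hT => ?_
                have := card_monoEvent_le_pow G (s ^ 2) i S T
                rwa [hSs, (mem_powersetCard.1 hT).2] at this
            _ = ((G.degree u).choose t : ℝ) * C := by
                rw [sum_const, card_powersetCard, nsmul_eq_mul, card_neighborFinset_eq_degree]
            _ ≤ ((s : ℝ) ^ 2) ^ t * C := by
                gcongr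
                have := (Nat.choose_le_pow (G.degree u) t).trans
                  (Nat.pow_le_pow_left (mem_filter.1 hu).2.le t)
                exact_mod_cast this
      _ = (#{u ∈ S | G.degree u < s ^ 2} : ℝ) * (((s : ℝ) ^ 2) ^ t * C) := by
          rw [sum_const, nsmul_eq_mul]
      _ ≤ s * (((s : ℝ) ^ 2) ^ t * C) := by
          gcongr
          exact (card_filter_le _ _).trans_eq hSs
  have htR : (0 : ℝ) < t := by exact_mod_cast ht
  have hW : (#({v | t ≤ G.degree v} : Finset V) : ℝ) ≤ 2 * (#G.edgeFinset : ℝ) / t := by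
    rw [le_div_iff₀ htR, mul_comm]
    exact mul_card_filter_le_degree G t
  calc _ ≤ ∑ S ∈ powersetCard s ({v | t ≤ G.degree v} : Finset V),
        (s * (((s : ℝ) ^ 2) ^ t * C)) := sum_le_sum hinner
    _ = ((#({v | t ≤ G.degree v} : Finset V)).choose s : ℝ) * (s * (((s : ℝ) ^ 2) ^ t * C)) := by
        rw [sum_const, card_powersetCard, nsmul_eq_mul]
    _ ≤ (2 * (#G.edgeFinset : ℝ) / t) ^ s * (s * (((s : ℝ) ^ 2) ^ t * C)) := by
        gcongr
        calc _ ≤ (#({v | t ≤ G.degree v} : Finset V) : ℝ) ^ s := by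
              exact_mod_cast Nat.choose_le_pow _ _
          _ ≤ _ := by gcongr
    _ = _ := by rw [hC]; ring

/-- Pairs `S × T` in which all vertices of `S` have high degree, sorted by a vertex `w` of `T` of
minimum degree. -/
theorem sum_monoEvent_high_le {s t : ℕ} (hs : 4 ≤ s) (hst : s ≤ t) {β : ℝ} (hβ : 0 < β)
    (hm : 32 * (#G.edgeFinset : ℝ) * (1 / 2) ^ s ≤ β * t * (s : ℝ) ^ 2) (i : Fin 2) :
    ∑ w with 1 ≤ G.degree w,
      ∑ S ∈ powersetCard s {u ∈ G.neighborFinset w | s ^ 2 ≤ G.degree u},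
        ∑ T ∈ powersetCard t ({v | G.degree w ≤ G.degree v} : Finset V),
          (#(monoEvent G (s ^ 2) i S T) : ℝ)
      ≤ 2 * (#G.edgeFinset : ℝ) * (((s : ℝ) ^ 2) ^ s * (Real.exp 1 * β) ^ t) *
        #(colorSpace G (s ^ 2)) := by
  set Ω : ℝ := ((#(colorSpace G (s ^ 2)) : ℕ) : ℝ)
  have hs2 : (0 : ℝ) < (s : ℝ) ^ 2 := by positivity
  have hinner : ∀ w, ∑ S ∈ powersetCard s {u ∈ G.neighborFinset w | s ^ 2 ≤ G.degree u},
        ∑ T ∈ powersetCard t ({v | G.degree w ≤ G.degree v} : Finset V),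
          (#(monoEvent G (s ^ 2) i S T) : ℝ)
        ≤ (((s : ℝ) ^ 2) ^ s * (Real.exp 1 * β) ^ t) * Ω := by
    intro w
    -- `M` plays two roles: there are at most `M ^ s` choices of `S`, and every `v` with degree at
    -- least that of `w` has weight `min 1 (deg v / s ^ 2) ≤ deg v / M`.
    set M : ℝ := max ((s : ℝ) ^ 2) (G.degree w) with hM
    have hM0 : 0 < M := lt_max_of_lt_left hs2
    have hMs : (s : ℝ) ^ 2 ≤ M := le_max_left _ _
    have hδ : 0 < β * ((s : ℝ) ^ 2 / M) := by positivity
    have hsum : ∑ v with G.degree w ≤ G.degree v,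
        16 * (1 / 2) ^ s * min 1 ((G.degree v : ℝ) / (s : ℝ) ^ 2)
          ≤ β * ((s : ℝ) ^ 2 / M) * t := by
      calc _ ≤ ∑ v with G.degree w ≤ G.degree v,
            16 * (1 / 2) ^ s * ((G.degree v : ℝ) / M) := by
            refine sum_le_sum fun v hv => ?_
            have hwv : (G.degree w : ℝ) ≤ G.degree v := by exact_mod_cast (mem_filter.1 hv).2
            gcongr
            rcases max_choice ((s : ℝ) ^ 2) (G.degree w : ℝ) with h | h
            · rw [hM, h]; exact min_le_right _ _
            · refine (min_le_left _ _).trans ((one_le_div hM0).2 ?_)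
              rw [hM, h]; exact hwv
        _ = 16 * (1 / 2) ^ s * (∑ v with G.degree w ≤ G.degree v, (G.degree v : ℝ)) / M := by
            rw [← mul_sum, ← sum_div, mul_div_assoc]
        _ ≤ 16 * (1 / 2) ^ s * (2 * (#G.edgeFinset : ℝ)) / M := by
            gcongr
            exact sum_degree_le G _
        _ ≤ (β * t * (s : ℝ) ^ 2) / M := by
            refine div_le_div_of_nonneg_right ?_ hM0.le
            linarith
        _ = _ := by ring
    have hT := sum_powersetCard_prod_le _ (fun v => by positivity) hδ hsum
    calc _ ≤ ∑ S ∈ powersetCard s {u ∈ G.neighborFinset w | s ^ 2 ≤ G.degree u},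
          (Real.exp 1 * (β * ((s : ℝ) ^ 2 / M))) ^ t * Ω := by
          refine sum_le_sum fun S hS => ?_
          rw [mem_powersetCard] at hS
          calc _ ≤ ∑ T ∈ powersetCard t ({v | G.degree w ≤ G.degree v} : Finset V),
                (∏ v ∈ T, 16 * (1 / 2) ^ s * min 1 ((G.degree v : ℝ) / (s : ℝ) ^ 2)) * Ω :=
                sum_le_sum fun T _ => card_monoEvent_le_prod G hs i T hS.2
                  fun u hu => (mem_filter.1 (hS.1 hu)).2
            _ ≤ _ := by
                rw [← sum_mul]
                gcongr
      _ = ((#{u ∈ G.neighborFinset w | s ^ 2 ≤ G.degree u}).choose s : ℝ) *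
          ((Real.exp 1 * (β * ((s : ℝ) ^ 2 / M))) ^ t * Ω) := by
          rw [sum_const, card_powersetCard, nsmul_eq_mul]
      _ ≤ M ^ s * ((Real.exp 1 * (β * ((s : ℝ) ^ 2 / M))) ^ t * Ω) := by
          gcongr
          calc _ ≤ (#{u ∈ G.neighborFinset w | s ^ 2 ≤ G.degree u} : ℝ) ^ s := by
                exact_mod_cast Nat.choose_le_pow _ _
            _ ≤ _ := by
                gcongr
                refine le_trans ?_ (le_max_right _ _)
                exact_mod_cast card_le_card (filter_subset _ _)
      _ = (M ^ s * ((s : ℝ) ^ 2 / M) ^ t) * (Real.exp 1 * β) ^ t * Ω := by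
          rw [← mul_assoc (Real.exp 1), mul_pow (Real.exp 1 * β)]; ring
      -- As `s ^ 2 ≤ M` and `s ≤ t`, the gain from a large degree of `w` outweighs the `M ^ s`
      -- choices of `S`.
      _ ≤ (M ^ s * ((s : ℝ) ^ 2 / M) ^ s) * (Real.exp 1 * β) ^ t * Ω := by
          have : ((s : ℝ) ^ 2 / M) ^ t ≤ ((s : ℝ) ^ 2 / M) ^ s :=
            pow_le_pow_of_le_one (by positivity) ((div_le_one hM0).2 hMs) hst
          gcongr
      _ = _ := by rw [← mul_pow, mul_div_cancel₀ _ hM0.ne']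
  calc _ ≤ ∑ w with 1 ≤ G.degree w, (((s : ℝ) ^ 2) ^ s * (Real.exp 1 * β) ^ t) * Ω :=
        sum_le_sum fun w _ => hinner w
    _ = (#{w | 1 ≤ G.degree w} : ℝ) * ((((s : ℝ) ^ 2) ^ s * (Real.exp 1 * β) ^ t) * Ω) := by
        rw [sum_const, nsmul_eq_mul]
    _ ≤ 2 * (#G.edgeFinset : ℝ) * ((((s : ℝ) ^ 2) ^ s * (Real.exp 1 * β) ^ t) * Ω) := by
        have := mul_card_filter_le_degree G 1
        rw [Nat.cast_one, one_mul] at this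
        gcongr
    _ = _ := by ring

/-- In a Ramsey graph, every outcome of the random coloring has a monochromatic pair `S × T` of
one of the two kinds. -/
theorem IsRamseyFor.card_colorSpace_le {G : SimpleGraph V} {s t : ℕ} (hs : 1 ≤ s) (ht : 1 ≤ t)
    (h : IsRamseyFor G (completeBipartiteGraph (Fin s) (Fin t))) :
    (#(colorSpace G (s ^ 2)) : ℝ) ≤
      ∑ i : Fin 2, (∑ S ∈ powersetCard s ({v | t ≤ G.degree v} : Finset V),
        ∑ u ∈ S with G.degree u < s ^ 2, ∑ T ∈ powersetCard t (G.neighborFinset u),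
          (#(monoEvent G (s ^ 2) i S T) : ℝ) +
      ∑ w with 1 ≤ G.degree w,
        ∑ S ∈ powersetCard s {u ∈ G.neighborFinset w | s ^ 2 ≤ G.degree u},
          ∑ T ∈ powersetCard t ({v | G.degree w ≤ G.degree v} : Finset V),
            (#(monoEvent G (s ^ 2) i S T) : ℝ)) := by
  let X : Fin 2 → Finset ((V → Finset V) × Finset (Sym2 V)) := fun i =>
    (powersetCard s ({v | t ≤ G.degree v} : Finset V)).biUnion fun S =>
      ({u ∈ S | G.degree u < s ^ 2}).biUnion fun u =>
        (powersetCard t (G.neighborFinset u)).biUnion fun T => monoEvent G (s ^ 2) i S T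
  let Y : Fin 2 → Finset ((V → Finset V) × Finset (Sym2 V)) := fun i =>
    ({w | 1 ≤ G.degree w} : Finset V).biUnion fun w =>
      (powersetCard s {u ∈ G.neighborFinset w | s ^ 2 ≤ G.degree u}).biUnion fun S =>
        (powersetCard t ({v | G.degree w ≤ G.degree v} : Finset V)).biUnion fun T =>
          monoEvent G (s ^ 2) i S T
  have hcover : colorSpace G (s ^ 2) ⊆ univ.biUnion fun i => X i ∪ Y i := by
    intro ω hω
    obtain ⟨i, hi⟩ := h (redLabeling G (s ^ 2) ω)
    rw [completeBipartiteGraph_isContained_iff] at hi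
    obtain ⟨S, T, hSs, hTt, hST⟩ := hi
    rw [Fintype.card_fin] at hSs hTt
    have hadj : ∀ u ∈ S, ∀ v ∈ T, G.Adj u v := fun u hu v hv =>
      ((redLabeling_labelGraph_adj G _).1 (hST hu hv)).1
    have hmono : ω ∈ monoEvent G (s ^ 2) i S T := mem_filter.2 ⟨hω, fun u hu v hv => hST hu hv⟩
    refine mem_biUnion.2 ⟨i, mem_univ i, mem_union.2 ?_⟩
    -- In the first case every vertex of `S` has degree at least `t`, being joined to all of `T`; in
    -- the second, `w` has minimum degree in `T`.
    by_cases hlow : ∃ u ∈ S, G.degree u < s ^ 2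
    · obtain ⟨u, hu, hud⟩ := hlow
      refine Or.inl (mem_biUnion.2 ⟨S, mem_powersetCard.2 ⟨fun x hx => ?_, hSs⟩, mem_biUnion.2
        ⟨u, mem_filter.2 ⟨hu, hud⟩, mem_biUnion.2 ⟨T, mem_powersetCard.2 ⟨fun v hv => ?_, hTt⟩,
          hmono⟩⟩⟩)
      · refine mem_filter.2 ⟨mem_univ x, ?_⟩
        rw [← hTt, ← card_neighborFinset_eq_degree]
        exact card_le_card fun v hv => (mem_neighborFinset ..).2 (hadj x hx v hv)
      · exact (mem_neighborFinset ..).2 (hadj u hu v hv)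
    · push Not at hlow
      obtain ⟨w, hw, hmin⟩ := exists_min_image T (fun v => G.degree v)
        (card_pos.1 (by omega))
      obtain ⟨u, hu⟩ := card_pos.1 (by omega : 0 < #S)
      refine Or.inr (mem_biUnion.2 ⟨w, mem_filter.2 ⟨mem_univ w, ?_⟩, mem_biUnion.2
        ⟨S, mem_powersetCard.2 ⟨fun x hx => mem_filter.2
          ⟨(mem_neighborFinset ..).2 (hadj x hx w hw).symm, hlow x hx⟩, hSs⟩, mem_biUnion.2
        ⟨T, mem_powersetCard.2 ⟨fun v hv => mem_filter.2 ⟨mem_univ v, hmin v hv⟩, hTt⟩, hmono⟩⟩⟩)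
      exact (G.degree_pos_iff_exists_adj w).2 ⟨u, (hadj u hu w hw).symm⟩
  have hnat : #(colorSpace G (s ^ 2)) ≤
      ∑ i : Fin 2, (∑ S ∈ powersetCard s ({v | t ≤ G.degree v} : Finset V),
        ∑ u ∈ S with G.degree u < s ^ 2, ∑ T ∈ powersetCard t (G.neighborFinset u),
          #(monoEvent G (s ^ 2) i S T) +
      ∑ w with 1 ≤ G.degree w,
        ∑ S ∈ powersetCard s {u ∈ G.neighborFinset w | s ^ 2 ≤ G.degree u},
          ∑ T ∈ powersetCard t ({v | G.degree w ≤ G.degree v} : Finset V),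
            #(monoEvent G (s ^ 2) i S T)) := by
    refine (card_le_card hcover).trans (card_biUnion_le.trans (sum_le_sum fun i _ => ?_))
    refine (card_union_le _ _).trans (Nat.add_le_add ?_ ?_)
    · exact card_biUnion_le.trans (sum_le_sum fun S _ => card_biUnion_le.trans
        (sum_le_sum fun u _ => card_biUnion_le))
    · exact card_biUnion_le.trans (sum_le_sum fun S _ => card_biUnion_le.trans
        (sum_le_sum fun u _ => card_biUnion_le))
  exact_mod_cast hnat

/-- The union bound over the random coloring. -/
theorem IsRamseyFor.one_le_union_bound {G : SimpleGraph V} {s t : ℕ} (hs : 4 ≤ s) (hst : s ≤ t)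
    (h : IsRamseyFor G (completeBipartiteGraph (Fin s) (Fin t))) {β : ℝ} (hβ : 0 < β)
    (hm : 32 * (G.edgeSet.ncard : ℝ) * (1 / 2) ^ s ≤ β * t * (s : ℝ) ^ 2) :
    1 ≤ 2 * ((2 * (G.edgeSet.ncard : ℝ) / t) ^ s * s * ((s : ℝ) ^ 2) ^ t *
        (2 ^ (s + t) * (1 / 2) ^ (s * t)) +
      2 * (G.edgeSet.ncard : ℝ) * (((s : ℝ) ^ 2) ^ s * (Real.exp 1 * β) ^ t)) := by
  have hcard : G.edgeSet.ncard = #G.edgeFinset := by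
    rw [← coe_edgeFinset, Set.ncard_coe_finset]
  rw [hcard] at hm ⊢
  have hΩ : (0 : ℝ) < #(colorSpace G (s ^ 2)) := by exact_mod_cast colorSpace_card_pos G (s ^ 2)
  have h1 := h.card_colorSpace_le (by omega) (by omega)
  have h2 := h1.trans (sum_le_sum fun i _ => add_le_add
    (sum_monoEvent_low_le G (by omega) i) (sum_monoEvent_high_le G hs hst hβ hm i))
  rw [sum_const, card_univ, Fintype.card_fin, nsmul_eq_mul, ← add_mul] at h2
  refine le_of_mul_le_mul_right ?_ hΩ
  rw [one_mul]
  refine h2.trans_eq ?_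
  push_cast
  ring

end Counting

/-! ### Numerical estimates and conclusion -/

theorem exists_forall_sixteen_mul_pow_five_le :
    ∃ n₀ : ℕ, ∀ s ≥ n₀, 16 * s ^ 5 ≤ 2 ^ (s / 2) := by
  have h := (tendsto_pow_const_div_const_pow_of_one_lt 5
    (by norm_num : (1 : ℝ) < 2)).eventually_le_const (by norm_num : (0 : ℝ) < 1 / (16 * 3 ^ 5))
  obtain ⟨n₁, hn₁⟩ := Filter.eventually_atTop.1 h
  refine ⟨2 * n₁ + 2, fun s hs => ?_⟩
  have h1 := hn₁ (s / 2) (by omega)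
  rw [div_le_iff₀ (by positivity), div_mul_eq_mul_div, le_div_iff₀ (by norm_num)] at h1
  have h2 : (s / 2) ^ 5 * (16 * 3 ^ 5) ≤ 1 * 2 ^ (s / 2) := by exact_mod_cast h1
  calc 16 * s ^ 5 ≤ 16 * (3 * (s / 2)) ^ 5 := by
        gcongr
        omega
    _ = (s / 2) ^ 5 * (16 * 3 ^ 5) := by ring
    _ ≤ _ := by linarith

/-- Half of the exponent in `2 ^ (-s * t)` beats the polynomial factors `s ^ (5 * t)` and `2 ^ (2 *
t)`; the other half beats `2 ^ (s * s)` because `4 * s ≤ t`. -/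
theorem low_union_term_le {s t : ℕ} {m : ℝ} (hm0 : 0 ≤ m) (hs : 1 ≤ s)
    (hs5 : 16 * s ^ 5 ≤ 2 ^ (s / 2)) (hst : 4 * s ≤ t) (hm : 2 * m / t ≤ (s : ℝ) ^ 2 * 2 ^ s) :
    (2 * m / t) ^ s * s * ((s : ℝ) ^ 2) ^ t * (2 ^ (s + t) * (1 / 2) ^ (s * t)) ≤ 1 / 4 := by
  have hs1 : (1 : ℝ) ≤ s := by exact_mod_cast hs
  have hs5R : 16 * (s : ℝ) ^ 5 ≤ 2 ^ (s / 2) := by exact_mod_cast hs5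
  have hexp : s / 2 * t + s * s ≤ s * t := by
    have h1 : 2 * (s / 2) ≤ s := Nat.mul_div_le s 2
    nlinarith
  calc _ ≤ ((s : ℝ) ^ 2 * 2 ^ s) ^ s * s * ((s : ℝ) ^ 2) ^ t *
        (2 ^ (s + t) * (1 / 2) ^ (s * t)) := by
        gcongr
    _ = (s : ℝ) ^ (2 * s + 1 + 2 * t) * 2 ^ (s + t) * 2 ^ (s * s) * (1 / 2) ^ (s * t) := by
        rw [mul_pow, ← pow_mul, ← pow_mul, ← pow_mul]; ring
    _ ≤ (s : ℝ) ^ (5 * t) * 2 ^ (2 * t) * 2 ^ (s * s) * (1 / 2) ^ (s * t) := by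
        gcongr
        · omega
        · norm_num
        · omega
    _ = (16 * (s : ℝ) ^ 5) ^ t * 2 ^ (s * s) * (1 / 2) ^ (s * t) * (1 / 4) ^ t := by
        rw [mul_pow, ← pow_mul, pow_mul 2 2 t]
        have : (16 : ℝ) ^ t * (1 / 4) ^ t = 4 ^ t := by rw [← mul_pow]; norm_num
        norm_num at this ⊢
        rw [← this]; ring
    _ ≤ (2 ^ (s / 2)) ^ t * 2 ^ (s * s) * (1 / 2) ^ (s * t) * (1 / 4) ^ 1 := by
        have : (1 / 4 : ℝ) ^ t ≤ (1 / 4) ^ 1 :=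
          pow_le_pow_of_le_one (by norm_num) (by norm_num) (by omega)
        gcongr
    _ = 2 ^ (s / 2 * t + s * s) * (1 / 2) ^ (s * t) * (1 / 4) := by
        rw [← pow_mul, pow_add, pow_one]
    _ ≤ 2 ^ (s * t) * (1 / 2) ^ (s * t) * (1 / 4) := by
        gcongr
        norm_num
    _ = 1 / 4 := by rw [← mul_pow]; norm_num

/-- The growth hypothesis on `t` gives `(s ^ 2) ^ s = 2 ^ (2 s log s) ≤ (2 ^ (2 / c)) ^ t`. With `s
^ 2 * t * 2 ^ s ≤ 16 ^ t` everything is a `t`-th power, whose base `16 * 96 * (a * 2 ^ (2 / c))` is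
at most `1 / 16`. -/
theorem high_union_term_lt {c : ℝ} (hc : 0 < c) {a m : ℝ} (ha0 : 0 < a)
    (ha : a * (2 : ℝ) ^ (2 / c) ≤ 1 / 24576) {s t : ℕ} (hs : 1 ≤ s) (hst : s ≤ t)
    (hct : c * ((s : ℝ) * Real.logb 2 (s : ℝ)) ≤ (t : ℝ))
    (hm : m ≤ a * ((s : ℝ) ^ 2 * (t : ℝ) * 2 ^ s)) :
    2 * m * (((s : ℝ) ^ 2) ^ s * (Real.exp 1 * (32 * a)) ^ t) < 1 / 4 := by
  have hs0 : (0 : ℝ) < s := by exact_mod_cast hs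
  have hK1 : (1 : ℝ) ≤ (2 : ℝ) ^ (2 / c) := Real.one_le_rpow (by norm_num) (by positivity)
  have ha1 : a ≤ 1 / 24576 := by nlinarith
  have hss : ((s : ℝ) ^ 2) ^ s ≤ ((2 : ℝ) ^ (2 / c)) ^ t := by
    have h1 : ((s : ℝ) ^ 2) ^ s = (2 : ℝ) ^ (2 * (s * Real.logb 2 s)) := by
      have h2 : (2 : ℝ) ^ Real.logb 2 (s : ℝ) = s :=
        Real.rpow_logb (by norm_num) (by norm_num) hs0
      rw [show 2 * ((s : ℝ) * Real.logb 2 s) = Real.logb 2 s * ((2 * s : ℕ) : ℝ) by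
        push_cast; ring, Real.rpow_mul (by norm_num), h2, Real.rpow_natCast, pow_mul]
    rw [h1, ← Real.rpow_natCast, ← Real.rpow_mul (by norm_num)]
    refine Real.rpow_le_rpow_of_exponent_le (by norm_num) ?_
    rw [div_mul_eq_mul_div, le_div_iff₀ hc]
    linarith
  have hs2 : (s : ℝ) ^ 2 ≤ 4 ^ t := by
    have h1 : s ≤ 2 ^ t := hst.trans Nat.lt_two_pow_self.le
    calc (s : ℝ) ^ 2 ≤ (2 ^ t) ^ 2 := by gcongr; exact_mod_cast h1
      _ = 4 ^ t := by rw [← pow_mul, mul_comm, pow_mul]; norm_num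
  have ht2 : (t : ℝ) ≤ 2 ^ t := by exact_mod_cast Nat.lt_two_pow_self.le
  have hp : (2 : ℝ) ^ s ≤ 2 ^ t := pow_le_pow_right₀ (by norm_num) hst
  have he : Real.exp 1 ≤ 3 := Real.exp_one_lt_three.le
  calc _ ≤ 2 * (a * (4 ^ t * 2 ^ t * 2 ^ t)) *
        (((2 : ℝ) ^ (2 / c)) ^ t * (3 * (32 * a)) ^ t) := by
        have h1 : m ≤ a * (4 ^ t * 2 ^ t * 2 ^ t) := hm.trans (by gcongr)
        gcongr
    _ = 2 * a * (16 * 96 * (a * (2 : ℝ) ^ (2 / c))) ^ t := by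
        have h4 : (4 : ℝ) ^ t * 2 ^ t * 2 ^ t = 16 ^ t := by
          rw [← mul_pow, ← mul_pow]; norm_num
        rw [h4, show (16 * 96 * (a * (2 : ℝ) ^ (2 / c)))
          = 16 * ((2 : ℝ) ^ (2 / c) * (3 * (32 * a))) by ring, mul_pow 16, mul_pow (2 ^ (2 / c))]
        generalize (3 * (32 * a)) ^ t = x
        ring
    _ ≤ 2 * a * 1 := by
        gcongr
        refine pow_le_one₀ (by positivity) ?_
        linarith
    _ < 1 / 4 := by linarith

theorem exists_lower_bound_of_large (c : ℝ) (hc : 0 < c) :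
    ∃ a : ℝ, 0 < a ∧ ∃ s₀ : ℕ, ∀ s ≥ s₀, ∀ t : ℕ,
      c * ((s : ℝ) * Real.logb 2 (s : ℝ)) ≤ (t : ℝ) → ∀ {V : Type} [Finite V] (G : SimpleGraph V),
        IsRamseyFor G (completeBipartiteGraph (Fin s) (Fin t)) →
          a * ((s : ℝ) ^ 2 * (t : ℝ) * 2 ^ s) ≤ (G.edgeSet.ncard : ℝ) := by
  obtain ⟨n₀, hn₀⟩ := exists_forall_sixteen_mul_pow_five_le
  have hK1 : (1 : ℝ) ≤ (2 : ℝ) ^ (2 / c) := Real.one_le_rpow (by norm_num) (by positivity)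
  -- For `s` beyond this threshold `log s ≥ 4 / c`, so that `t ≥ c s log s ≥ 4 s`.
  obtain ⟨n₁, hn₁⟩ := exists_nat_ge ((2 : ℝ) ^ (4 / c))
  refine ⟨1 / 24576 / (2 : ℝ) ^ (2 / c), by positivity, n₀ + n₁ + 4, ?_⟩
  intro s hs t hct V _ G hG
  have := Fintype.ofFinite V
  set a : ℝ := 1 / 24576 / (2 : ℝ) ^ (2 / c) with ha
  have ha0 : 0 < a := by positivity
  have haK : a * (2 : ℝ) ^ (2 / c) ≤ 1 / 24576 := by
    rw [ha, div_mul_cancel₀ _ (by positivity)]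
  have ha1 : a ≤ 1 / 24576 := by nlinarith
  have hs0 : (0 : ℝ) < s := by exact_mod_cast (by omega)
  have hlog : 4 / c ≤ Real.logb 2 s := by
    rw [Real.le_logb_iff_rpow_le (by norm_num) hs0]
    refine hn₁.trans ?_
    exact_mod_cast (by omega)
  have hst : 4 * s ≤ t := by
    have h1 : 4 * (s : ℝ) ≤ t := by
      rw [div_le_iff₀ hc] at hlog
      nlinarith
    exact_mod_cast h1
  have ht0 : (0 : ℝ) < t := by exact_mod_cast (by omega)
  by_contra! hlt
  have hm0 : (0 : ℝ) ≤ (G.edgeSet.ncard : ℝ) := Nat.cast_nonneg _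
  have hu := hG.one_le_union_bound (by omega) (by omega) (β := 32 * a) (by positivity) (by
    calc 32 * (G.edgeSet.ncard : ℝ) * (1 / 2) ^ s
        ≤ 32 * (a * ((s : ℝ) ^ 2 * (t : ℝ) * 2 ^ s)) * (1 / 2) ^ s := by gcongr
      _ = 32 * a * t * (s : ℝ) ^ 2 * (2 ^ s * (1 / 2) ^ s) := by ring
      _ = _ := by rw [← mul_pow]; norm_num)
  have h1 := low_union_term_le hm0 (by omega) (hn₀ s (by omega)) hst (by
    rw [div_le_iff₀ ht0]
    have : 0 ≤ (s : ℝ) ^ 2 * (t : ℝ) * 2 ^ s := by positivity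
    nlinarith)
  have h2 := high_union_term_lt hc ha0 haK (by omega) (by omega) hct hlt.le
  linarith

theorem mainTheorem2 (c : ℝ) (hc : 0 < c) :
    ∃ a b : ℝ, 0 < a ∧ 0 < b ∧
      ∀ s t : ℕ, 1 ≤ s → 1 ≤ t → c * ((s : ℝ) * Real.logb 2 (s : ℝ)) ≤ (t : ℝ) →
        a * ((s : ℝ) ^ 2 * (t : ℝ) * 2 ^ s)
            ≤ (sizeRamsey (completeBipartiteGraph (Fin s) (Fin t)) : ℝ) ∧
        (sizeRamsey (completeBipartiteGraph (Fin s) (Fin t)) : ℝ)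
            ≤ b * ((s : ℝ) ^ 2 * (t : ℝ) * 2 ^ s) := by
  obtain ⟨a, ha, s₀, hlarge⟩ := exists_lower_bound_of_large c hc
  -- The second term of the minimum covers `s < s₀`, where the trivial bound `s * t` suffices. The
  -- constant `16` comes from `4 s ^ 2` times `4 t 2 ^ s` edges, with `q = 2 s ^ 2`.
  refine ⟨min a (1 / ((s₀ + 1) * 2 ^ s₀)), 16, by positivity, by norm_num, ?_⟩
  intro s t hs _ hct
  have hR : IsRamseyFor _ _ := isRamseyFor_completeBipartiteGraph (t := t) hs le_rfl
  constructor
  · obtain ⟨n, G, hG, hcard⟩ := exists_isRamseyFor_ncard_eq_sizeRamsey hR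
    rw [← hcard]
    rcases le_or_gt s₀ s with h | h
    · refine le_trans ?_ (hlarge s h t hct G hG)
      gcongr
      exact min_le_left _ _
    · have h1 : (s : ℝ) * t ≤ G.edgeSet.ncard := by exact_mod_cast hG.mul_le_ncard
      refine le_trans ?_ h1
      calc _ ≤ 1 / (((s₀ : ℝ) + 1) * 2 ^ s₀) * ((s : ℝ) ^ 2 * (t : ℝ) * 2 ^ s) := by
            gcongr
            exact min_le_right _ _
        _ = (s * t) * ((s * 2 ^ s) / (((s₀ : ℝ) + 1) * 2 ^ s₀)) := by ring
        _ ≤ (s * t) * 1 := by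
            gcongr
            refine div_le_one_of_le₀ ?_ (by positivity)
            have h2 : (s : ℝ) ≤ s₀ + 1 := by exact_mod_cast (by omega)
            have h3 : (2 : ℝ) ^ s ≤ 2 ^ s₀ := pow_le_pow_right₀ (by norm_num) h.le
            gcongr
        _ = _ := mul_one _
  · have h1 := sizeRamsey_le_ncard hR
    rw [ncard_edgeSet_completeBipartiteGraph] at h1
    calc (sizeRamsey (completeBipartiteGraph (Fin s) (Fin t)) : ℝ)
        ≤ ((2 * (2 * s ^ 2) * (4 * t * 2 ^ s) : ℕ) : ℝ) := by exact_mod_cast h1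
      _ = _ := by push_cast; ring
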